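/- Let $\mathbb{T} = \mathbb{R} \cup \{-\infty\} \cup \{a^\nu : a \in \mathbb{R}\}$ be Izhakian's extended tropical semiring, where $a \mapsto a^\nu$ is a bijection of $\mathbb{R}$ onto a disjoint copy. Its addition $\oplus$ is commutative with neutral element $-\infty$ and, for $a, b \in \mathbb{R}$, satisfies: if $a < b$, then $x \oplus y = y$ for all $x \in \{a, a^\nu\}$, $y \in \{b, b^\nu\}$; and $x \oplus y = a^\nu$ for all $x, y \in \{a, a^\nu\}$. Its multiplication $\odot$ is commutative with absorbing element $-\infty$ and, for $a, b \in \mathbb{R}$, satisfies $a \odot b = a + b$ and $a^\nu \odot b = a \odot b^\nu = a^\nu \odot b^\nu = (a+b)^\nu$. Thus $\mathbb{T}$ is a unital commutative semiring with zero $-\infty$ and unit the real number $0$. A unital commutative semiring $X$, with $\nu(x) := x + x$, is called supertropical if $2 = 4$ in $X$, if $a + b \in \{a, b\}$ for all $a, b \in X$ with $\nu(a) \neq \nu(b)$, and if $a + b = \nu(a)$ for all $a, b \in X$ with $\nu(a) = \nu(b)$. A polynomial in $n$ variables over $X$ is a function $X^n \to X$ represented by a formal polynomial with coefficients in $X$;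 it is symmetric if it is represented by a formal polynomial that is invariant under all permutations of the variables. For $1 \le j \le n$, let $e_j \colon X^n \to X$ be the sum of all products of $j$ different variables. $X$ is called fully elementary if for every $n \in \mathbb{N} = \{0, 1, 2, \ldots\}$ and every symmetric polynomial $p$ in $n$ variables over $X$ there is a polynomial $r$ in $n$ variables over $X$ such that \[ p(x_1, \ldots, x_n) = r\big(e_1(x_1, \ldots, x_n), \ldots, e_n(x_1, \ldots, x_n)\big) \quad \text{for all } x_1, \ldots, x_n \in X. \] Theorem. The extended tropical semiring $\mathbb{T}$ is supertropical and fully elementary. -/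

import Mathlib

/-! ### Polynomials over commutative semirings and elementarity -/

/-- A function `X ^ n → X` is a polynomial if a formal polynomial (a finite sum of monomials
`a * x_1 ^ d_1 * ... * x_n ^ d_n`) represents it. -/
def IsPolynomialFun {X : Type*} [CommSemiring X] {n : ℕ} (p : (Fin n → X) → X) : Prop :=
  ∃ P : MvPolynomial (Fin n) X, ∀ x : Fin n → X, p x = MvPolynomial.eval x P

/-- A polynomial function is symmetric if a *formal* polynomial that is invariant under all
permutations of the variables represents it. -/
def IsSymmetricPolynomialFun {X : Type*} [CommSemiring X] {n : ℕ}
    (p : (Fin n → X) → X) : Prop :=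
  ∃ P : MvPolynomial (Fin n) X, P.IsSymmetric ∧ ∀ x : Fin n → X, p x = MvPolynomial.eval x P

/-- The function `X ^ n → X` given by the `j`-th elementary symmetric polynomial: the sum of all
products of `j` different variables. -/
def elemSymm {X : Type*} [CommSemiring X] {n : ℕ} (j : ℕ) (x : Fin n → X) : X :=
  ∑ t ∈ Finset.powersetCard j (Finset.univ : Finset (Fin n)), ∏ i ∈ t, x i

/-- `X` is `n`-elementary: each symmetric polynomial in `n` variables is a polynomial in the
elementary symmetric polynomials `e_1, ..., e_n` (the index `i : Fin n` stands for `e_{i+1}`). -/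
def IsElementary (X : Type*) [CommSemiring X] (n : ℕ) : Prop :=
  ∀ p : (Fin n → X) → X, IsSymmetricPolynomialFun p →
    ∃ r : (Fin n → X) → X, IsPolynomialFun r ∧
      ∀ x : Fin n → X, p x = r (fun i : Fin n => elemSymm ((i : ℕ) + 1) x)

/-- `X` is fully elementary: it is `n`-elementary for all natural numbers `n`. -/
def IsFullyElementary (X : Type*) [CommSemiring X] : Prop :=
  ∀ n : ℕ, IsElementary X n

/-! ### Supertropical semirings -/

/-- The ghost map `ν x = x + x`. -/
def ghostMap {X : Type*} [CommSemiring X] (x : X) : X := x + x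

/-- A supertropical semiring. -/
structure IsSupertropical (X : Type*) [CommSemiring X] : Prop where
  two_eq_four : (2 : X) = 4
  add_of_ne : ∀ a b : X, ghostMap a ≠ ghostMap b → a + b = a ∨ a + b = b
  add_of_eq : ∀ a b : X, ghostMap a = ghostMap b → a + b = ghostMap a

/-! ### Izhakian's extended tropical semiring -/

/-- The underlying set `ℝ ∪ {-∞} ∪ ℝ^ν` of the extended tropical semiring: the element `-∞`, the
(tangible) real numbers `a`, and a ghost copy `a^ν` of each real number `a`. -/
inductive ExtendedTropical : Type
  | negInf : ExtendedTropical
  | tangible (a : ℝ) : ExtendedTropical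
  | ghost (a : ℝ) : ExtendedTropical

namespace ExtendedTropical

open Classical in
/-- Addition: `-∞` is neutral; the element over the larger real number wins; two elements over the
same real number `a` add up to the ghost `a^ν`. -/
noncomputable def add : ExtendedTropical → ExtendedTropical → ExtendedTropical
  | negInf, y => y
  | x, negInf => x
  | tangible a, tangible b =>
      if a < b then tangible b else if b < a then tangible a else ghost a
  | tangible a, ghost b => if b < a then tangible a else ghost b
  | ghost a, tangible b => if a < b then tangible b else ghost a
  | ghost a, ghost b => ghost (max a b)

/-- Multiplication: addition of the underlying real numbers, with `-∞` absorbing; a product of two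
elements different from `-∞` is a ghost if at least one of the factors is. -/
noncomputable def mul : ExtendedTropical → ExtendedTropical → ExtendedTropical
  | negInf, _ => negInf
  | _, negInf => negInf
  | tangible a, tangible b => tangible (a + b)
  | tangible a, ghost b => ghost (a + b)
  | ghost a, tangible b => ghost (a + b)
  | ghost a, ghost b => ghost (a + b)

noncomputable instance : Zero ExtendedTropical := ⟨negInf⟩
noncomputable instance : One ExtendedTropical := ⟨tangible 0⟩
noncomputable instance : Add ExtendedTropical := ⟨add⟩
noncomputable instance : Mul ExtendedTropical := ⟨mul⟩

theorem zero_def : (0 : ExtendedTropical) = negInf := rfl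
theorem one_def : (1 : ExtendedTropical) = tangible 0 := rfl
theorem add_def (x y : ExtendedTropical) : x + y = add x y := rfl
theorem mul_def (x y : ExtendedTropical) : x * y = mul x y := rfl

protected theorem add_comm' (x y : ExtendedTropical) : x + y = y + x := by
  cases x <;> cases y <;> simp only [add_def, add, max_def] <;> grind

protected theorem add_assoc' (x y z : ExtendedTropical) : x + y + z = x + (y + z) := by
  cases x <;> cases y <;> cases z <;> simp only [add_def, add, max_def] <;>
    split_ifs <;> grind

protected theorem mul_comm' (x y : ExtendedTropical) : x * y = y * x := by
  cases x <;> cases y <;> simp only [mul_def, mul] <;> grind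

protected theorem mul_assoc' (x y z : ExtendedTropical) : x * y * z = x * (y * z) := by
  cases x <;> cases y <;> cases z <;> simp only [mul_def, mul] <;> grind

protected theorem mul_add' (x y z : ExtendedTropical) : x * (y + z) = x * y + x * z := by
  cases x <;> cases y <;> cases z <;> simp only [add_def, mul_def, add, mul, max_def] <;>
    split_ifs <;> grind

noncomputable instance : CommSemiring ExtendedTropical where
  add_assoc := ExtendedTropical.add_assoc'
  zero_add x := by cases x <;> rfl
  add_zero x := by cases x <;> rfl
  add_comm := ExtendedTropical.add_comm'
  nsmul := nsmulRec
  mul_assoc := ExtendedTropical.mul_assoc'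
  one_mul x := by cases x <;> simp [one_def, mul_def, mul]
  mul_one x := by cases x <;> simp [one_def, mul_def, mul]
  zero_mul x := by cases x <;> rfl
  mul_zero x := by cases x <;> rfl
  left_distrib := ExtendedTropical.mul_add'
  right_distrib x y z := by
    rw [ExtendedTropical.mul_comm', ExtendedTropical.mul_add', ExtendedTropical.mul_comm' z x,
      ExtendedTropical.mul_comm' z y]
  mul_comm := ExtendedTropical.mul_comm'

end ExtendedTropical

/-! Addition in the semiring is governed by magnitude: the strictly larger summand wins, and a tie
gives a ghost that depends only on the common magnitude. A symmetric formal polynomial has constant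
coefficients on orbits of exponents, so it suffices to treat the orbit sum of a single monomial
`d₀`. This sum equals the product over `k` of `e_{c_k}`, where `c_k` counts the `i` with `k < d₀ i`
(the conjugate partition).

To see this, permute `d₀` so that larger exponents sit at larger magnitudes, and cut `x ^ d₀` into
layers `{i | k < d₀ i}`. Each layer is an upper set, hence a maximal term of `e_{c_k}`, and `x ^ d₀`
is a maximal term of the orbit sum. If no two different exponents share a magnitude, both sides
equal `x ^ d₀`; otherwise both sides equal its ghost (`sum_orbit_eq_of_monovary`). -/

open scoped NNReal

/-! ### Magnitudes, ghosts and the supertropical axioms -/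

namespace ExtendedTropical

/-- The magnitude of an element: `0` for `-∞`, and `exp a` for the two elements over `a`. -/
noncomputable def mag : ExtendedTropical →*₀ ℝ≥0 where
  toFun
    | negInf => 0
    | tangible a => ⟨Real.exp a, (Real.exp_pos a).le⟩
    | ghost a => ⟨Real.exp a, (Real.exp_pos a).le⟩
  map_zero' := rfl
  map_one' := by
    apply NNReal.eq
    exact Real.exp_zero
  map_mul' x y := by
    cases x <;> cases y <;> apply NNReal.eq <;> rw [NNReal.coe_mul]
    exacts [(zero_mul _).symm, (zero_mul _).symm, (zero_mul _).symm, (mul_zero _).symm,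
      Real.exp_add _ _, Real.exp_add _ _, (mul_zero _).symm, Real.exp_add _ _, Real.exp_add _ _]

theorem mag_negInf : mag negInf = 0 := rfl

theorem coe_mag_tangible (a : ℝ) : (mag (tangible a) : ℝ) = Real.exp a := rfl

theorem coe_mag_ghost (a : ℝ) : (mag (ghost a) : ℝ) = Real.exp a := rfl

theorem mag_eq_zero {x : ExtendedTropical} : mag x = 0 ↔ x = 0 := by
  cases x <;> simp [zero_def, ← NNReal.coe_inj, coe_mag_tangible, coe_mag_ghost, mag_negInf]

theorem add_eq_right_of_mag_lt {x y : ExtendedTropical} (h : mag x < mag y) : x + y = y := by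
  cases x <;> cases y <;>
    simp_all [← NNReal.coe_lt_coe, coe_mag_tangible, coe_mag_ghost, mag_negInf, add_def, add,
      not_lt_of_ge, le_of_lt]

theorem add_eq_left_of_mag_lt {x y : ExtendedTropical} (h : mag y < mag x) : x + y = x := by
  rw [add_comm, add_eq_right_of_mag_lt h]

theorem add_eq_ghostMap {x y : ExtendedTropical} (h : mag x = mag y) : x + y = ghostMap x := by
  unfold ghostMap
  cases x <;> cases y <;>
    simp_all [← NNReal.coe_inj, coe_mag_tangible, coe_mag_ghost, mag_negInf, add_def, add,
      (Real.exp_ne_zero _).symm]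

theorem mag_ghostMap (x : ExtendedTropical) : mag (ghostMap x) = mag x := by
  cases x <;> simp [ghostMap, ← NNReal.coe_inj, coe_mag_tangible, coe_mag_ghost, mag_negInf,
    add_def, add]

theorem mag_add (x y : ExtendedTropical) : mag (x + y) = max (mag x) (mag y) := by
  rcases lt_trichotomy (mag x) (mag y) with h | h | h
  · rw [add_eq_right_of_mag_lt h, max_eq_right h.le]
  · rw [add_eq_ghostMap h, mag_ghostMap, h, max_self]
  · rw [add_eq_left_of_mag_lt h, max_eq_left h.le]

theorem ghostMap_eq_iff {x y : ExtendedTropical} : ghostMap x = ghostMap y ↔ mag x = mag y := by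
  refine ⟨fun h => by rw [← mag_ghostMap, h, mag_ghostMap], fun h => ?_⟩
  rw [← add_eq_ghostMap h, add_comm, add_eq_ghostMap h.symm]

theorem ghostMap_mul (x y : ExtendedTropical) : ghostMap x * y = ghostMap (x * y) :=
  add_mul x x y

theorem ghostMap_ghostMap (x : ExtendedTropical) : ghostMap (ghostMap x) = ghostMap x :=
  ghostMap_eq_iff.2 (mag_ghostMap x)

theorem isSupertropical : IsSupertropical ExtendedTropical where
  two_eq_four := by
    have h := ghostMap_ghostMap 1
    simp only [ghostMap, one_add_one_eq_two] at h
    rw [← h]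
    norm_num
  add_of_ne a b h := by
    rcases lt_trichotomy (mag a) (mag b) with h' | h' | h'
    · exact Or.inr (add_eq_right_of_mag_lt h')
    · exact absurd (ghostMap_eq_iff.2 h') h
    · exact Or.inl (add_eq_left_of_mag_lt h')
  add_of_eq a b h := add_eq_ghostMap (ghostMap_eq_iff.1 h)

/-! ### Dominant terms, ties and ghost factors -/

section Sums

variable {ι : Type*} {s : Finset ι} {f : ι → ExtendedTropical}

theorem mag_sum_le {c : ℝ≥0} (h : ∀ i ∈ s, mag (f i) ≤ c) : mag (∑ i ∈ s, f i) ≤ c := by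
  classical
  induction s using Finset.induction_on with
  | empty => simp
  | insert a s ha ih =>
    rw [Finset.sum_insert ha, mag_add]
    exact max_le (h a (by simp)) (ih fun i hi => h i (by simp [hi]))

theorem mag_sum_lt {c : ℝ≥0} (hc : 0 < c) (h : ∀ i ∈ s, mag (f i) < c) :
    mag (∑ i ∈ s, f i) < c := by
  classical
  induction s using Finset.induction_on with
  | empty => simpa
  | insert a s ha ih =>
    rw [Finset.sum_insert ha, mag_add]
    exact max_lt (h a (by simp)) (ih fun i hi => h i (by simp [hi]))

theorem mag_le_mag_sum {i : ι} (hi : i ∈ s) : mag (f i) ≤ mag (∑ i ∈ s, f i) := by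
  classical
  rw [← Finset.add_sum_erase s f hi, mag_add]
  exact le_max_left _ _

/-- Strictness is needed only for a nonzero maximum: if the maximal term is `-∞`, so are all the
terms. -/
theorem sum_eq_of_strict_max {i₀ : ι} (h₀ : i₀ ∈ s) (hle : ∀ i ∈ s, mag (f i) ≤ mag (f i₀))
    (hlt : f i₀ ≠ 0 → ∀ i ∈ s, i ≠ i₀ → mag (f i) < mag (f i₀)) :
    ∑ i ∈ s, f i = f i₀ := by
  classical
  by_cases h : f i₀ = 0
  · rw [h]
    refine Finset.sum_eq_zero fun i hi => mag_eq_zero.1 ?_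
    simpa [h] using hle i hi
  · rw [← Finset.add_sum_erase s f h₀]
    refine add_eq_left_of_mag_lt (mag_sum_lt (pos_iff_ne_zero.2 (mag_eq_zero.not.2 h)) ?_)
    intro i hi
    exact hlt h i (Finset.mem_of_mem_erase hi) (Finset.ne_of_mem_erase hi)

theorem sum_eq_ghostMap_of_tie {i₀ i₁ : ι} (h₀ : i₀ ∈ s) (h₁ : i₁ ∈ s) (hne : i₁ ≠ i₀)
    (hle : ∀ i ∈ s, mag (f i) ≤ mag (f i₀)) (heq : mag (f i₁) = mag (f i₀)) :
    ∑ i ∈ s, f i = ghostMap (f i₀) := by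
  classical
  rw [← Finset.add_sum_erase s f h₀]
  refine add_eq_ghostMap (le_antisymm ?_ (mag_sum_le fun i hi => hle i (Finset.mem_of_mem_erase hi)))
  rw [← heq]
  exact mag_le_mag_sum (Finset.mem_erase.2 ⟨hne, h₁⟩)

theorem prod_eq_or_eq_ghostMap {g : ι → ExtendedTropical}
    (h : ∀ i ∈ s, f i = g i ∨ f i = ghostMap (g i)) :
    ∏ i ∈ s, f i = ∏ i ∈ s, g i ∨ ∏ i ∈ s, f i = ghostMap (∏ i ∈ s, g i) := by
  classical
  induction s using Finset.induction_on with
  | empty => simp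
  | insert a s ha ih =>
    rw [Finset.prod_insert ha, Finset.prod_insert ha]
    rcases h a (by simp) with h1 | h1 <;> rcases ih fun i hi => h i (by simp [hi]) with h2 | h2 <;>
      rw [h1, h2]
    · exact Or.inl rfl
    · right; rw [mul_comm, ghostMap_mul, mul_comm]
    · right; rw [ghostMap_mul]
    · right; rw [ghostMap_mul, mul_comm, ghostMap_mul, ghostMap_ghostMap, mul_comm]

/-- Ghosts absorb: `ghostMap` pulls out of any factor and is idempotent, so one ghost factor decides
the product. -/
theorem prod_eq_ghostMap {g : ι → ExtendedTropical}
    (h : ∀ i ∈ s, f i = g i ∨ f i = ghostMap (g i)) {i₀ : ι} (h₀ : i₀ ∈ s)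
    (hi₀ : f i₀ = ghostMap (g i₀)) : ∏ i ∈ s, f i = ghostMap (∏ i ∈ s, g i) := by
  classical
  rw [← Finset.mul_prod_erase s f h₀, ← Finset.mul_prod_erase s g h₀, hi₀]
  rcases prod_eq_or_eq_ghostMap (s := s.erase i₀) (f := f) (g := g)
    fun i hi => h i (Finset.mem_of_mem_erase hi) with h2 | h2 <;> rw [h2, ghostMap_mul]
  rw [mul_comm, ghostMap_mul, ghostMap_ghostMap, mul_comm]

end Sums

end ExtendedTropical

/-! ### Products over upper sets and layers -/

section Products

variable {ι : Type*}

theorem NNReal.prod_le_prod_of_card_eq {a b : Finset ι} {y : ι → ℝ≥0} (hcard : a.card = b.card)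
    (h : ∀ i ∈ b, ∀ j ∈ a, y j ≤ y i) : ∏ j ∈ a, y j ≤ ∏ i ∈ b, y i :=
  -- The supremum over `a` separates the factors of the two products.
  calc ∏ j ∈ a, y j ≤ (a.sup y) ^ a.card :=
        Finset.prod_le_pow_card _ _ _ fun j hj => Finset.le_sup hj
    _ = (a.sup y) ^ b.card := by rw [hcard]
    _ = ∏ i ∈ b, a.sup y := by simp
    _ ≤ ∏ i ∈ b, y i := Finset.prod_le_prod' fun i hi => Finset.sup_le (h i hi)

theorem NNReal.prod_lt_prod_of_card_eq {a b : Finset ι} {y : ι → ℝ≥0} (hcard : a.card = b.card)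
    (hne : b.Nonempty) (h : ∀ i ∈ b, ∀ j ∈ a, y j < y i) : ∏ j ∈ a, y j < ∏ i ∈ b, y i := by
  have hane : a.Nonempty := by rwa [← Finset.card_pos, hcard, Finset.card_pos]
  have hpos : ∀ i ∈ b, 0 < y i := fun i hi =>
    zero_le.trans_lt (h i hi _ hane.choose_spec)
  by_cases hz : ∃ j ∈ a, y j = 0
  · obtain ⟨j, hj, hj0⟩ := hz
    rw [Finset.prod_eq_zero hj hj0]
    exact Finset.prod_pos hpos
  · push Not at hz
    have hsup : ∀ i ∈ b, a.sup y < y i := fun i hi =>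
      (Finset.sup_lt_iff (hpos i hi)).2 (h i hi)
    have hsup0 : 0 < a.sup y :=
      (pos_iff_ne_zero.2 (hz _ hane.choose_spec)).trans_le (Finset.le_sup hane.choose_spec)
    calc ∏ j ∈ a, y j ≤ (a.sup y) ^ a.card :=
          Finset.prod_le_pow_card _ _ _ fun j hj => Finset.le_sup hj
      _ = ∏ i ∈ b, a.sup y := by simp [hcard]
      _ < ∏ i ∈ b, y i := Finset.prod_lt_prod_of_nonempty (fun _ _ => hsup0) hsup hne

/-- Among the sets of a given size, an upper set has the largest product. -/
theorem NNReal.prod_le_prod_of_upper [DecidableEq ι] {t t₀ : Finset ι} {y : ι → ℝ≥0} (hcard : t.card = t₀.card)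
    (h : ∀ i ∈ t₀, ∀ j ∉ t₀, y j ≤ y i) : ∏ j ∈ t, y j ≤ ∏ i ∈ t₀, y i := by
  rw [← Finset.prod_inter_mul_prod_sdiff t t₀, ← Finset.prod_inter_mul_prod_sdiff t₀ t,
    Finset.inter_comm]
  refine mul_le_mul_right (NNReal.prod_le_prod_of_card_eq (Finset.card_sdiff_comm hcard) ?_) _
  intro i hi j hj
  exact h i (Finset.mem_sdiff.1 hi).1 j (Finset.mem_sdiff.1 hj).2

/-- The common factors cancel, which requires them to be nonzero; the differences are nonempty and
have equal size. -/
theorem NNReal.prod_lt_prod_of_upper [DecidableEq ι] {t t₀ : Finset ι} {y : ι → ℝ≥0} (hcard : t.card = t₀.card)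
    (h : ∀ i ∈ t₀, ∀ j ∉ t₀, y j < y i) (hne : t ≠ t₀) (h0 : ∏ i ∈ t₀, y i ≠ 0) :
    ∏ j ∈ t, y j < ∏ i ∈ t₀, y i := by
  rw [← Finset.prod_inter_mul_prod_sdiff t₀ t] at h0 ⊢
  rw [← Finset.prod_inter_mul_prod_sdiff t t₀, Finset.inter_comm]
  refine mul_lt_mul_of_pos_left (NNReal.prod_lt_prod_of_card_eq
    (Finset.card_sdiff_comm hcard) ?_ ?_) (pos_iff_ne_zero.2 (left_ne_zero_of_mul h0))
  · rw [Finset.sdiff_nonempty]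
    exact fun hs => hne (Finset.eq_of_subset_of_card_le hs hcard.le).symm
  · intro i hi j hj
    exact h i (Finset.mem_sdiff.1 hi).1 j (Finset.mem_sdiff.1 hj).2

theorem Equiv.apply_swap_eq_of_eq [DecidableEq ι] {α : Type*} {y : ι → α} {i j : ι} (h : y i = y j) (k : ι) :
    y (Equiv.swap i j k) = y k := by
  rw [Equiv.swap_apply_def]
  split_ifs with h1 h2
  · rw [h1, h]
  · rw [h2, h]
  · rfl

/-- Layer-cake decomposition: `y i` occurs in exactly the layers `k = 0, ..., d i - 1`. -/
theorem Finset.prod_pow_eq_prod_range {M : Type*} [CommMonoid M] [Fintype ι] (y : ι → M)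
    (d : ι → ℕ) {N : ℕ} (hN : ∀ i, d i ≤ N) :
    ∏ i, y i ^ d i = ∏ k ∈ Finset.range N, ∏ i with k < d i, y i := by
  simp_rw [Finset.prod_filter]
  rw [Finset.prod_comm]
  refine Finset.prod_congr rfl fun i _ => ?_
  rw [← Finset.prod_filter, Finset.prod_const]
  congr 1
  rw [show (Finset.range N).filter (fun k => k < d i) = Finset.range (d i) by
    ext k; have := hN i; simp; omega, Finset.card_range]

end Products

/-! ### Orbit sums as products of elementary symmetric polynomials -/

namespace ExtendedTropical

variable {n : ℕ} {x : Fin n → ExtendedTropical}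

theorem elemSymm_eq_prod {t₀ : Finset (Fin n)} (h : ∀ i ∈ t₀, ∀ j ∉ t₀, mag (x j) < mag (x i)) :
    elemSymm t₀.card x = ∏ i ∈ t₀, x i := by
  refine sum_eq_of_strict_max (f := fun t => ∏ i ∈ t, x i) (by simp) (fun t ht => ?_)
    fun h0 t ht hne => ?_
  · simp only [map_prod]
    exact NNReal.prod_le_prod_of_upper (Finset.mem_powersetCard.1 ht).2
      fun i hi j hj => (h i hi j hj).le
  · simp only [map_prod]
    refine NNReal.prod_lt_prod_of_upper (Finset.mem_powersetCard.1 ht).2 h hne ?_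
    rw [← map_prod]
    exact mag_eq_zero.not.2 h0

/-- Exchanging `i` for `j` in `t₀` gives a second term of maximal magnitude. -/
theorem elemSymm_eq_ghostMap {t₀ : Finset (Fin n)}
    (h : ∀ i ∈ t₀, ∀ j ∉ t₀, mag (x j) ≤ mag (x i)) {i j : Fin n} (hi : i ∈ t₀) (hj : j ∉ t₀)
    (hij : mag (x i) = mag (x j)) :
    elemSymm t₀.card x = ghostMap (∏ i ∈ t₀, x i) := by
  refine sum_eq_ghostMap_of_tie (f := fun t => ∏ i ∈ t, x i)
    (i₁ := t₀.map (Equiv.swap i j).toEmbedding) (by simp) (by simp) ?_ (fun t ht => ?_) ?_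
  · intro he
    apply hj
    rw [← he]
    exact Finset.mem_map.2 ⟨i, hi, by simp⟩
  · simp only [map_prod]
    exact NNReal.prod_le_prod_of_upper (Finset.mem_powersetCard.1 ht).2 h
  · simp only [map_prod, Finset.prod_map, Equiv.coe_toEmbedding]
    exact Finset.prod_congr rfl fun k _ =>
      Equiv.apply_swap_eq_of_eq (y := fun k => mag (x k)) hij k

theorem card_filter_lt_comp_perm (d : Fin n → ℕ) (σ : Equiv.Perm (Fin n)) (k : ℕ) :
    (Finset.univ.filter fun i => k < d (σ i)).card = (Finset.univ.filter fun i => k < d i).card :=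
  Finset.card_bijective σ σ.bijective (by simp)

/-- On the extended tropical semiring, a monomial symmetric polynomial is a product of elementary
symmetric polynomials, for an exponent that varies together with the magnitudes. -/
theorem sum_orbit_eq_of_monovary {d₀ : Fin n →₀ ℕ} {s : Finset (Fin n →₀ ℕ)} {N : ℕ}
    (hN : ∀ i, d₀ i ≤ N) (hs : ∀ d, d ∈ s ↔ ∃ σ : Equiv.Perm (Fin n), ∀ i, d i = d₀ (σ i))
    (hx : ∀ i j, d₀ i < d₀ j → mag (x i) ≤ mag (x j)) :
    ∑ d ∈ s, ∏ i, x i ^ d i =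
      ∏ k ∈ Finset.range N, elemSymm (Finset.univ.filter fun i => k < d₀ i).card x := by
  have hsN : ∀ d ∈ s, ∀ i, d i ≤ N := fun d hd i => by
    obtain ⟨σ, hσ⟩ := (hs d).1 hd
    rw [hσ]; exact hN _
  have h₀ : d₀ ∈ s := (hs d₀).2 ⟨1, fun _ => rfl⟩
  have hcard : ∀ d ∈ s, ∀ k, (Finset.univ.filter fun i => k < d i).card =
      (Finset.univ.filter fun i => k < d₀ i).card := fun d hd k => by
    obtain ⟨σ, hσ⟩ := (hs d).1 hd
    simp_rw [hσ]
    exact card_filter_lt_comp_perm d₀ σ k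
  have hup : ∀ k, ∀ i ∈ Finset.univ.filter (fun i => k < d₀ i),
      ∀ j ∉ Finset.univ.filter (fun i => k < d₀ i), mag (x j) ≤ mag (x i) := by
    intro k i hi j hj
    simp only [Finset.mem_filter, Finset.mem_univ, true_and, not_lt] at hi hj
    exact hx j i (hj.trans_lt hi)
  have hlayer : ∀ d ∈ s, mag (∏ i, x i ^ d i) =
      ∏ k ∈ Finset.range N, ∏ i with k < d i, mag (x i) := fun d hd => by
    rw [Finset.prod_pow_eq_prod_range x d (hsN d hd)]
    simp only [map_prod]
  have hlayer_le : ∀ d ∈ s, ∀ k, ∏ i with k < d i, mag (x i) ≤ ∏ i with k < d₀ i, mag (x i) :=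
    fun d hd k => NNReal.prod_le_prod_of_upper (hcard d hd k) (hup k)
  have hle : ∀ d ∈ s, mag (∏ i, x i ^ d i) ≤ mag (∏ i, x i ^ d₀ i) := fun d hd => by
    rw [hlayer d hd, hlayer d₀ h₀]
    exact Finset.prod_le_prod' fun k _ => hlayer_le d hd k
  by_cases htie : ∃ i j, d₀ j < d₀ i ∧ mag (x i) = mag (x j)
  -- Swapping the exponents at `i` and `j` gives a different monomial of the same magnitude, so the
  -- orbit sum is a ghost.
  · obtain ⟨i, j, hlt, hij⟩ := htie
    rw [sum_eq_ghostMap_of_tie (f := fun d : Fin n →₀ ℕ => ∏ i, x i ^ d i)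
      (i₁ := Finsupp.equivMapDomain (Equiv.swap i j) d₀) h₀ ?_ ?_ hle ?_,
      Finset.prod_pow_eq_prod_range x d₀ hN]
    · symm
      -- The layer `k = d₀ j` contains `i` but not `j`, so its elementary factor is a ghost.
      refine prod_eq_ghostMap (i₀ := d₀ j) (fun k _ => ?_)
        (Finset.mem_range.2 (hlt.trans_le (hN i))) ?_
      · by_cases hk : ∃ i ∈ Finset.univ.filter (fun i => k < d₀ i),
          ∃ j ∉ Finset.univ.filter (fun i => k < d₀ i), mag (x i) = mag (x j)
        · obtain ⟨i, hi, j, hj, hij⟩ := hk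
          exact Or.inr (elemSymm_eq_ghostMap (hup k) hi hj hij)
        · push Not at hk
          exact Or.inl (elemSymm_eq_prod fun i hi j hj =>
            lt_of_le_of_ne (hup k i hi j hj) (hk i hi j hj).symm)
      · exact elemSymm_eq_ghostMap (hup _) (i := i) (j := j) (by simpa using hlt) (by simp) hij
    · exact (hs _).2 ⟨Equiv.swap i j, fun k => by simp [Finsupp.equivMapDomain_apply]⟩
    · intro he
      have := DFunLike.congr_fun he i
      simp [Finsupp.equivMapDomain_apply] at this
      omega
    · simp only [map_prod, map_pow, Finsupp.equivMapDomain_apply, Equiv.symm_swap]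
      refine Fintype.prod_equiv (Equiv.swap i j) _ _ fun k => ?_
      rw [Equiv.apply_swap_eq_of_eq (y := fun k => mag (x k)) hij k]
  · push Not at htie
    have hstrict : ∀ k, ∀ i ∈ Finset.univ.filter (fun i => k < d₀ i),
        ∀ j ∉ Finset.univ.filter (fun i => k < d₀ i), mag (x j) < mag (x i) := by
      intro k i hi j hj
      refine lt_of_le_of_ne (hup k i hi j hj) (htie i j ?_).symm
      simp only [Finset.mem_filter, Finset.mem_univ, true_and, not_lt] at hi hj
      exact hj.trans_lt hi
    rw [Finset.prod_congr rfl fun k _ => elemSymm_eq_prod (hstrict k),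
      ← Finset.prod_pow_eq_prod_range x d₀ hN]
    refine sum_eq_of_strict_max (f := fun d : Fin n →₀ ℕ => ∏ i, x i ^ d i) h₀ hle
      fun h0 d hd hne => ?_
    have hpos : ∏ k ∈ Finset.range N, ∏ i with k < d₀ i, mag (x i) ≠ 0 := by
      rw [← hlayer d₀ h₀]
      exact mag_eq_zero.not.2 h0
    -- Layers determine the exponent, so a different `d` differs in some layer, and there it loses
    -- strictly.
    obtain ⟨k, hkN, hk⟩ : ∃ k ∈ Finset.range N, (Finset.univ.filter fun i => k < d i) ≠
        Finset.univ.filter fun i => k < d₀ i := by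
      by_contra! hall
      refine hne (Finsupp.ext fun i => le_antisymm ?_ ?_) <;> by_contra! hlt
      · have := Finset.ext_iff.1 (hall (d₀ i)
          (Finset.mem_range.2 (hlt.trans_le (hsN d hd i)))) i
        simp at this
        omega
      · have := Finset.ext_iff.1 (hall (d i) (Finset.mem_range.2 (hlt.trans_le (hN i)))) i
        simp at this
        omega
    have hklt := NNReal.prod_lt_prod_of_upper (hcard d hd k) (hstrict k) hk
      (Finset.prod_ne_zero_iff.1 hpos k hkN)
    rw [hlayer d hd, hlayer d₀ h₀, ← Finset.mul_prod_erase _ _ hkN,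
      ← Finset.mul_prod_erase _ (fun k => ∏ i with k < d₀ i, mag (x i)) hkN]
    rw [← Finset.mul_prod_erase _ _ hkN] at hpos
    exact mul_lt_mul_of_lt_of_le_of_nonneg_of_pos hklt
      (Finset.prod_le_prod' fun k _ => hlayer_le d hd k) zero_le
      (pos_iff_ne_zero.2 (right_ne_zero_of_mul hpos))

theorem sum_orbit_eq {d₀ : Fin n →₀ ℕ} {s : Finset (Fin n →₀ ℕ)} {N : ℕ}
    (hN : ∀ i, d₀ i ≤ N) (hs : ∀ d, d ∈ s ↔ ∃ σ : Equiv.Perm (Fin n), ∀ i, d i = d₀ (σ i)) :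
    ∑ d ∈ s, ∏ i, x i ^ d i =
      ∏ k ∈ Finset.range N, elemSymm (Finset.univ.filter fun i => k < d₀ i).card x := by
  let τ := Tuple.sort fun i => mag (x i)
  let ρ := Tuple.sort d₀
  -- This sends the index of the `m`-th smallest magnitude to that of the `m`-th smallest exponent.
  -- It depends on `x`, but the layer sizes do not.
  let π : Equiv.Perm (Fin n) := ρ * τ⁻¹
  let d₁ : Fin n →₀ ℕ := Finsupp.equivMapDomain π.symm d₀
  have hd₁ : ∀ i, d₁ i = d₀ (π i) := fun i => by simp [d₁, Finsupp.equivMapDomain_apply]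
  rw [sum_orbit_eq_of_monovary (d₀ := d₁) (fun i => hd₁ i ▸ hN _) (fun d => ?_) fun i j hij => ?_]
  · simp_rw [hd₁]
    exact Finset.prod_congr rfl fun k _ => by rw [card_filter_lt_comp_perm d₀ π k]
  · rw [hs]
    constructor
    · rintro ⟨σ, hσ⟩
      exact ⟨π⁻¹ * σ, fun i => by simp [hσ, hd₁]⟩
    · rintro ⟨σ, hσ⟩
      exact ⟨π * σ, fun i => by simp [hσ, hd₁]⟩
  · rw [hd₁, hd₁] at hij
    have hlt : τ⁻¹ i < τ⁻¹ j := (Tuple.monotone_sort d₀).reflect_lt hij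
    simpa [τ, Equiv.Perm.inv_def] using Tuple.monotone_sort (fun i => mag (x i)) hlt.le

/-! ### From orbit sums to symmetric polynomials -/

theorem exists_eval_eq_elemSymm {j : ℕ} (hj : j ≤ n) :
    ∃ Q : MvPolynomial (Fin n) ExtendedTropical, ∀ x : Fin n → ExtendedTropical,
      MvPolynomial.eval (fun i : Fin n => elemSymm ((i : ℕ) + 1) x) Q = elemSymm j x := by
  cases j with
  -- `e_0 = 1` is not among the variables; it arises from empty layers.
  | zero => exact ⟨1, fun x => by simp [elemSymm]⟩
  | succ j => exact ⟨MvPolynomial.X ⟨j, hj⟩, fun x => by simp⟩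

theorem exists_eval_eq_sum_orbit {d₀ : Fin n →₀ ℕ} {s : Finset (Fin n →₀ ℕ)}
    (hs : ∀ d, d ∈ s ↔ ∃ σ : Equiv.Perm (Fin n), ∀ i, d i = d₀ (σ i)) :
    ∃ Q : MvPolynomial (Fin n) ExtendedTropical, ∀ x : Fin n → ExtendedTropical,
      MvPolynomial.eval (fun i : Fin n => elemSymm ((i : ℕ) + 1) x) Q =
        ∑ d ∈ s, ∏ i, x i ^ d i := by
  have hcard : ∀ k, (Finset.univ.filter fun i => k < d₀ i).card ≤ n := fun k =>
    (Finset.card_le_univ _).trans_eq (Fintype.card_fin n)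
  choose Q hQ using fun k => exists_eval_eq_elemSymm (hcard k)
  refine ⟨∏ k ∈ Finset.range (Finset.univ.sup d₀), Q k, fun x => ?_⟩
  rw [sum_orbit_eq (fun i => Finset.le_sup (Finset.mem_univ i)) hs, map_prod]
  exact Finset.prod_congr rfl fun k _ => hQ k x

theorem isFullyElementary : IsFullyElementary ExtendedTropical := by
  rintro n p ⟨P, hP, hp⟩
  -- The sorted exponent is a complete invariant of the permutation orbit.
  let key : (Fin n →₀ ℕ) → Fin n → ℕ := fun d => d ∘ Tuple.sort d
  have hkey : ∀ d d', key d = key d' ↔ ∃ σ : Equiv.Perm (Fin n), ∀ i, d i = d' (σ i) := by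
    intro d d'
    constructor
    · intro h
      refine ⟨Tuple.sort d' * (Tuple.sort d)⁻¹, fun i => ?_⟩
      simpa [key, Equiv.Perm.inv_def] using congr_fun h ((Tuple.sort d)⁻¹ i)
    · rintro ⟨σ, hσ⟩
      simp only [key, show ⇑d = d' ∘ σ from funext hσ]
      exact Tuple.comp_perm_comp_sort_eq_comp_sort
  have hcoeff : ∀ d d', key d = key d' → P.coeff d = P.coeff d' := by
    intro d d' h
    obtain ⟨σ, hσ⟩ := (hkey d d').1 h
    have hd : d' = d.mapDomain σ := by
      ext i
      rw [← Finsupp.equivMapDomain_eq_mapDomain, Finsupp.equivMapDomain_apply, hσ]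
      simp
    rw [hd, ← MvPolynomial.coeff_rename_mapDomain σ σ.injective P d, hP σ]
  have hfiber : ∀ d₀ ∈ P.support, ∀ d, d ∈ P.support.filter (fun d => key d = key d₀) ↔
      ∃ σ : Equiv.Perm (Fin n), ∀ i, d i = d₀ (σ i) := by
    intro d₀ h₀ d
    rw [Finset.mem_filter, ← hkey, and_iff_right_iff_imp]
    intro h
    rw [MvPolynomial.mem_support_iff] at h₀ ⊢
    rwa [hcoeff d d₀ h]
  have hQ : ∀ κ ∈ P.support.image key, ∃ Q : MvPolynomial (Fin n) ExtendedTropical,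
      ∀ x : Fin n → ExtendedTropical,
        MvPolynomial.eval (fun i : Fin n => elemSymm ((i : ℕ) + 1) x) Q =
          ∑ d ∈ P.support with key d = κ, P.coeff d * ∏ i, x i ^ d i := by
    intro κ hκ
    obtain ⟨d₀, h₀, rfl⟩ := Finset.mem_image.1 hκ
    obtain ⟨Q, hQ⟩ := exists_eval_eq_sum_orbit (hfiber d₀ h₀)
    refine ⟨MvPolynomial.C (P.coeff d₀) * Q, fun x => ?_⟩
    rw [map_mul, MvPolynomial.eval_C, hQ, Finset.mul_sum]
    exact Finset.sum_congr rfl fun d hd => by rw [hcoeff d d₀ (Finset.mem_filter.1 hd).2]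
  choose! Q hQ using hQ
  refine ⟨fun y => MvPolynomial.eval y (∑ κ ∈ P.support.image key, Q κ), ⟨_, fun _ => rfl⟩,
    fun x => ?_⟩
  simp only [hp, map_sum]
  rw [MvPolynomial.eval_eq', Finset.sum_congr rfl fun κ hκ => hQ κ hκ x]
  exact (Finset.sum_fiberwise_of_maps_to (fun d hd => Finset.mem_image_of_mem key hd) _).symm

end ExtendedTropical

theorem mainTheorem8 :
    IsSupertropical ExtendedTropical ∧ IsFullyElementary ExtendedTropical :=
  ⟨ExtendedTropical.isSupertropical, ExtendedTropical.isFullyElementary⟩
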